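/- Let $G$ be a Hausdorff topological group, let $H$ be a closed subgroup of $G$, and let $X=G/H$ be the coset $G$-space, with the quotient topology and the action of $G$ by left translations. Conventions. A $G$-space is a topological space with a jointly continuous action of $G$. A compact Hausdorff $G$-space $Y$ is called SUC if for every $y\in Y$ and every entourage $\varepsilon$ of the unique compatible uniformity of $Y$ there is a neighbourhood $U$ of the identity of $G$ such that $(guy,gy)\in\varepsilon$ for all $g\in G$ and $u\in U$. A bounded continuous function $f\colon X\to\mathbb R$ is called SUC if there are a compact Hausdorff SUC $G$-space $Y$, a continuous $G$-equivariant map $\nu\colon X\to Y$ with dense range, and a continuous function $F\colon Y\to\mathbb R$ such that $f=F\circ\nu$. The $G$-space $X$ is called SUC-trivial if every SUC function on $X$ is constant. A topological $G$-group is a Hausdorff topological group with a jointly continuous action of $G$ by group automorphisms. The free topological $G$-group $F_G(X)$ is the topological $G$-group, equipped with a continuous $G$-map $i\colon X\to F_G(X)$, which is universal: for every continuous $G$-map $\varphi\colon X\to P$ into a topological $G$-group $P$ there is a unique continuous $G$-equivariant homomorphism $\Phi\colon F_G(X)\to P$ with $\Phi\circ i=\varphi$. Then: 1. If $x_1,x_2\in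 X$ have the same image under the canonical map $i\colon X\to F_G(X)$, then $f(x_1)=f(x_2)$ for every SUC function $f$ on $X$. 2. If the inclusion $H\hookrightarrow G$ is an epimorphism in the category of Hausdorff topological groups and continuous homomorphisms (that is, any two continuous homomorphisms from $G$ into a Hausdorff topological group which agree on $H$ are equal), then $X=G/H$ is SUC-trivial. -/

import Mathlib

open scoped Topology Uniformity BoundedContinuousFunction

universe u v w

noncomputable section

/-! ### Strongly uniformly continuous (SUC) systems and functions -/

/-- A uniform `G`-space `Y` is strongly uniformly continuous at `y` if the orbit map `g ↦ g • y` is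
uniformly continuous from the left uniformity of `G` to `Y`: for every entourage `ε` there is a
neighbourhood `U` of `1` in `G` with `((g * u) • y, g • y) ∈ ε` for all `g : G` and `u ∈ U`. -/
def IsSUCAt (G : Type u) {Y : Type v} [Group G] [TopologicalSpace G] [MulAction G Y]
    [UniformSpace Y] (y : Y) : Prop :=
  ∀ ε ∈ 𝓤 Y, ∃ U ∈ 𝓝 (1 : G), ∀ g : G, ∀ u ∈ U, ((g * u) • y, g • y) ∈ ε

/-- A uniform `G`-space is SUC if it is strongly uniformly continuous at each of its points. -/
def IsSUCSpace (G : Type u) (Y : Type v) [Group G] [TopologicalSpace G] [MulAction G Y]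
    [UniformSpace Y] : Prop :=
  ∀ y : Y, IsSUCAt G y

/-- The map `ν : X → Y` of `G`-spaces is continuous, equivariant and has dense range. If `Y` is a
compact Hausdorff `G`-space, this says that `ν` is a `G`-compactification of `X`
(which need not be an embedding). -/
structure IsGCompactificationMap (G : Type u) {X : Type v} {Y : Type w} [Group G] [MulAction G X]
    [MulAction G Y] [TopologicalSpace X] [TopologicalSpace Y] (ν : X → Y) : Prop where
  continuous : Continuous ν
  map_smul : ∀ (g : G) (x : X), ν (g • x) = g • ν x
  denseRange : DenseRange ν

/-- A bounded continuous function `f` on a `G`-space `X` is SUC if it comes from a compact SUC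
`G`-system: there are a compact Hausdorff `G`-space `Y` (with jointly continuous action) that is
SUC for its unique compatible uniformity, a `G`-compactification `ν : X → Y`, and a continuous
`F : Y → ℝ` with `f = F ∘ ν`. As `ν` has dense range and `Y` is Hausdorff, the cardinality of `Y`
is at most that of the double power set of `X`, so taking `Y` in the universe of `X`
is no restriction. -/
def IsSUCFunction (G : Type u) {X : Type v} [Group G] [TopologicalSpace G] [TopologicalSpace X]
    [MulAction G X] (f : X →ᵇ ℝ) : Prop :=
  ∃ (Y : Type v) (_ : UniformSpace Y) (_ : CompactSpace Y) (_ : T2Space Y) (_ : MulAction G Y)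
    (_ : ContinuousSMul G Y), IsSUCSpace G Y ∧
      ∃ ν : X → Y, IsGCompactificationMap G ν ∧ ∃ F : C(Y, ℝ), ∀ x : X, f x = F (ν x)

/-- `x₁` and `x₂` cannot be separated by an SUC function. -/
def SUCEquivalent (G : Type u) {X : Type v} [Group G] [TopologicalSpace G] [TopologicalSpace X]
    [MulAction G X] (x₁ x₂ : X) : Prop :=
  ∀ f : X →ᵇ ℝ, IsSUCFunction G f → f x₁ = f x₂

/-- A `G`-space is SUC-trivial if every SUC function on it is constant. -/
def IsSUCTrivial (G : Type u) (X : Type v) [Group G] [TopologicalSpace G] [TopologicalSpace X]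
    [MulAction G X] : Prop :=
  ∀ f : X →ᵇ ℝ, IsSUCFunction G f → ∃ c : ℝ, ∀ x : X, f x = c

/-! ### The free topological `G`-group of a `G`-space

A topological `G`-group is a Hausdorff topological group with a jointly continuous action of `G` by
group automorphisms. -/

/-- The abstract free group on `X`, as a carrier for the action of `G` induced from `X` and for the
finest compatible topology. -/
def PreFreeGGroup (_G : Type u) (X : Type v) : Type v := FreeGroup X

namespace PreFreeGGroup

variable (G : Type u) (X : Type v)

instance : Group (PreFreeGGroup G X) := inferInstanceAs (Group (FreeGroup X))

/-- The inclusion of the free generators. -/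
def of (x : X) : PreFreeGGroup G X := FreeGroup.of x

variable [Group G] [MulAction G X]

/-- `G` acts on the free group by automorphisms, permuting the free generators. -/
instance : MulDistribMulAction G (PreFreeGGroup G X) where
  smul g a := FreeGroup.map (fun x : X => g • x) a
  one_smul a := by
    change FreeGroup.map (fun x : X => (1 : G) • x) a = a
    simp only [one_smul]
    exact FreeGroup.map.id a
  mul_smul g h a := by
    change FreeGroup.map (fun x : X => (g * h) • x) a =
      FreeGroup.map (fun x : X => g • x) (FreeGroup.map (fun x : X => h • x) a)
    simp only [mul_smul]
    exact (FreeGroup.map.comp (fun x : X => h • x) (fun x : X => g • x) a).symm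
  smul_one g := map_one (FreeGroup.map (fun x : X => g • x))
  smul_mul g a b := map_mul (FreeGroup.map (fun x : X => g • x)) a b

theorem smul_of (g : G) (x : X) : g • of G X x = of G X (g • x) :=
  FreeGroup.map.of

variable [TopologicalSpace G] [TopologicalSpace X]

/-- The group topologies on the free group for which the action of `G` is jointly continuous and
the inclusion of generators is continuous. -/
def admissible : Set (TopologicalSpace (PreFreeGGroup G X)) :=
  {t | @IsTopologicalGroup (PreFreeGGroup G X) t _ ∧
    @ContinuousSMul G (PreFreeGGroup G X) _ _ t ∧
    @Continuous X (PreFreeGGroup G X) _ t (of G X)}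

/-- The finest admissible topology (in Mathlib's order on topologies, finer is smaller). -/
instance : TopologicalSpace (PreFreeGGroup G X) := sInf (admissible G X)

instance : IsTopologicalGroup (PreFreeGGroup G X) := topologicalGroup_sInf fun _ ht => ht.1

instance : ContinuousSMul G (PreFreeGGroup G X) := continuousSMul_sInf fun _ ht => ht.2.1

theorem continuous_of : Continuous (of G X) := continuous_sInf_rng.2 fun _ ht => ht.2.2

end PreFreeGGroup

/-- The free topological `G`-group `F_G(X)`: the Hausdorff quotient of the free group on `X` with
the finest group topology making the action of `G` and the inclusion of `X` continuous. -/
abbrev FreeTopologicalGGroup (G : Type u) (X : Type v) [Group G] [MulAction G X]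
    [TopologicalSpace G] [TopologicalSpace X] : Type v :=
  SeparationQuotient (PreFreeGGroup G X)

namespace FreeTopologicalGGroup

variable (G : Type u) (X : Type v) [Group G] [MulAction G X] [TopologicalSpace G]
  [TopologicalSpace X]

/-- The action of `G` on `F_G(X)` is by group automorphisms. -/
instance : MulDistribMulAction G (FreeTopologicalGGroup G X) where
  smul_one g := congrArg SeparationQuotient.mk (smul_one g)
  smul_mul g := SeparationQuotient.surjective_mk.forall₂.2 fun a b =>
    congrArg SeparationQuotient.mk (smul_mul' g a b)

/-- The canonical map `X → F_G(X)`. -/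
def of (x : X) : FreeTopologicalGGroup G X := SeparationQuotient.mk (PreFreeGGroup.of G X x)

theorem continuous_of : Continuous (of G X) :=
  SeparationQuotient.continuous_mk.comp (PreFreeGGroup.continuous_of G X)

theorem smul_of (g : G) (x : X) : g • of G X x = of G X (g • x) :=
  congrArg SeparationQuotient.mk (PreFreeGGroup.smul_of G X g x)

/-- `F_G(X)` is a topological `G`-group. -/
theorem isTopologicalGGroup : IsTopologicalGroup (FreeTopologicalGGroup G X) ∧
    T2Space (FreeTopologicalGGroup G X) ∧ ContinuousSMul G (FreeTopologicalGGroup G X) :=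
  ⟨inferInstance, inferInstance, inferInstance⟩

variable {G X}

/-- The universal property of `F_G(X)`: each continuous `G`-map from `X` to a topological `G`-group
`P` factors through a unique continuous equivariant group homomorphism `F_G(X) → P`. -/
theorem existsUnique_lift {P : Type w} [Group P] [TopologicalSpace P] [IsTopologicalGroup P]
    [T2Space P] [MulDistribMulAction G P] [ContinuousSMul G P] (φ : X → P) (hφ : Continuous φ)
    (hsmul : ∀ (g : G) (x : X), φ (g • x) = g • φ x) :
    ∃! Φ : FreeTopologicalGGroup G X →* P, Continuous Φ ∧
      (∀ (g : G) (a : FreeTopologicalGGroup G X), Φ (g • a) = g • Φ a) ∧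
      ∀ x : X, Φ (of G X x) = φ x := by
  let L : PreFreeGGroup G X →* P := FreeGroup.lift φ
  have hLof : ∀ x : X, L (PreFreeGGroup.of G X x) = φ x := fun x => FreeGroup.lift_apply_of
  have hL : ∀ (g : G) (a : PreFreeGGroup G X), L (g • a) = g • L a := by
    intro g a
    have h : L.comp (MulDistribMulAction.toMonoidHom (PreFreeGGroup G X) g) =
        (MulDistribMulAction.toMonoidHom P g).comp L :=
      FreeGroup.ext_hom _ _ fun x => by
        change L (g • PreFreeGGroup.of G X x) = g • L (PreFreeGGroup.of G X x)
        rw [PreFreeGGroup.smul_of, hLof, hLof, hsmul]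
    exact DFunLike.congr_fun h a
  have hadm : TopologicalSpace.induced L inferInstance ∈ PreFreeGGroup.admissible G X := by
    refine ⟨topologicalGroup_induced L, ?_, ?_⟩
    · let _ : TopologicalSpace (PreFreeGGroup G X) := TopologicalSpace.induced L inferInstance
      refine ⟨continuous_induced_rng.2 ?_⟩
      have : (L ∘ fun p : G × PreFreeGGroup G X => p.1 • p.2) = fun p => p.1 • L p.2 :=
        funext fun p => hL p.1 p.2
      rw [this]
      exact continuous_fst.smul (continuous_induced_dom.comp continuous_snd)
    · exact continuous_induced_rng.2 (by convert hφ using 1; exact funext hLof)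
  have hLc : Continuous L := continuous_iff_le_induced.2 (sInf_le hadm)
  have hins : ∀ a b : PreFreeGGroup G X, Inseparable a b → L a = L b := fun a b h =>
    (h.map hLc).eq
  refine ⟨{ toFun := SeparationQuotient.lift L hins
            map_one' := map_one L
            map_mul' := SeparationQuotient.surjective_mk.forall₂.2 fun a b => map_mul L a b },
    ⟨?_, ?_, hLof⟩, ?_⟩
  · exact SeparationQuotient.continuous_lift hLc
  · exact fun g => SeparationQuotient.surjective_mk.forall.2 fun a => hL g a
  · rintro Ψ ⟨-, -, hΨ⟩
    have h : Ψ.comp (SeparationQuotient.mkMonoidHom (M := PreFreeGGroup G X)) = L :=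
      FreeGroup.ext_hom _ _ fun x => (hΨ x).trans (hLof x).symm
    ext a
    obtain ⟨a, rfl⟩ := SeparationQuotient.surjective_mk a
    exact DFunLike.congr_fun h a

end FreeTopologicalGGroup

/-- `x₁` and `x₂` have the same image under the canonical map `X → F_G(X)`. -/
def AutEquivalent (G : Type u) {X : Type v} [Group G] [MulAction G X] [TopologicalSpace G]
    [TopologicalSpace X] (x₁ x₂ : X) : Prop :=
  FreeTopologicalGGroup.of G X x₁ = FreeTopologicalGGroup.of G X x₂

/-! ### Epimorphisms of Hausdorff topological groups -/

/-- The inclusion of a subgroup, as a continuous homomorphism. -/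
def Subgroup.continuousInclusion {G : Type u} [Group G] [TopologicalSpace G] (H : Subgroup G) :
    H →ₜ* G where
  toMonoidHom := H.subtype
  continuous_toFun := continuous_subtype_val

/-- A morphism `i : A → B` is an epimorphism in the category of Hausdorff topological groups
and continuous homomorphisms. -/
def IsEpiHausdorffGroup {A B : Type u} [Group A] [TopologicalSpace A] [Group B]
    [TopologicalSpace B] (i : A →ₜ* B) : Prop :=
  ∀ (K : Type u) [Group K] [TopologicalSpace K] [IsTopologicalGroup K] [T2Space K]
    (φ ψ : B →ₜ* K), φ.comp i = ψ.comp i → φ = ψ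

end

/-! For an SUC function `f` on `X` and a point `x`, the function `t ↦ f (t • x)` on `G` is bounded
and uniformly continuous for the left uniformity. Such functions form, under addition, the sup norm
and right translation, a topological `G`-group `P`, and `φ x = (t ↦ f (t • x))` is a continuous
`G`-map from `G ⧸ H` to `P` with `f x = φ x 1`. Part 1 follows because `φ` factors through `F_G(X)`.
For part 2, `φ` sends the base coset to an `H`-fixed point `p`. In `P ⋊ G`, the inclusion of `G` and
its conjugate by `p` agree exactly on the stabiliser of `p`; if `H → G` is an epimorphism they
coincide, so `p` is `G`-fixed, and `φ`, hence `f`, is constant by transitivity. -/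

noncomputable section

/-! ### Semidirect products of topological groups -/

namespace SemidirectProduct

variable {N : Type*} {G : Type*} [Group N] [Group G] {φ : G →* MulAut N}
  [TopologicalSpace N] [TopologicalSpace G]

instance : TopologicalSpace (N ⋊[φ] G) := TopologicalSpace.induced equivProd inferInstance

theorem continuous_equivProd : Continuous (equivProd : N ⋊[φ] G → N × G) :=
  continuous_induced_dom

theorem continuous_left : Continuous (left : N ⋊[φ] G → N) :=
  continuous_fst.comp continuous_equivProd

theorem continuous_right : Continuous (right : N ⋊[φ] G → G) :=
  continuous_snd.comp continuous_equivProd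

theorem continuous_iff {X : Type*} [TopologicalSpace X] {f : X → N ⋊[φ] G} :
    Continuous f ↔ (Continuous fun x => (f x).left) ∧ Continuous fun x => (f x).right :=
  ⟨fun h => ⟨continuous_left.comp h, continuous_right.comp h⟩,
    fun h => continuous_induced_rng.2 (h.1.prodMk h.2)⟩

instance [T2Space N] [T2Space G] : T2Space (N ⋊[φ] G) :=
  T2Space.of_injective_continuous equivProd.injective continuous_equivProd

theorem isTopologicalGroup [IsTopologicalGroup N] [IsTopologicalGroup G]
    (hφ : Continuous fun p : G × N => φ p.1 p.2) : IsTopologicalGroup (N ⋊[φ] G) where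
  continuous_mul := continuous_iff.2
    ⟨(continuous_left.comp continuous_fst).mul (hφ.comp
        ((continuous_right.comp continuous_fst).prodMk (continuous_left.comp continuous_snd))),
      (continuous_right.comp continuous_fst).mul (continuous_right.comp continuous_snd)⟩
  continuous_inv := continuous_iff.2
    ⟨hφ.comp (continuous_right.inv.prodMk continuous_left.inv), continuous_right.inv⟩

end SemidirectProduct

/-- If the inclusion of `H` in `G` is an epimorphism, then every `H`-fixed point of a topological
`G`-group is `G`-fixed. -/
theorem IsEpiHausdorffGroup.smul_eq_of_forall_mem {G P : Type u} [Group G] [TopologicalSpace G]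
    [IsTopologicalGroup G] [T2Space G] [Group P] [TopologicalSpace P] [IsTopologicalGroup P]
    [T2Space P] [MulDistribMulAction G P] [ContinuousSMul G P] {H : Subgroup G}
    (hH : IsEpiHausdorffGroup H.continuousInclusion) {p : P} (hp : ∀ h ∈ H, h • p = p) (g : G) :
    g • p = p := by
  let φ : G →* MulAut P := MulDistribMulAction.toMulAut G P
  have : IsTopologicalGroup (P ⋊[φ] G) := SemidirectProduct.isTopologicalGroup continuous_smul
  let α : G →ₜ* P ⋊[φ] G :=
    { toMonoidHom := SemidirectProduct.inr
      continuous_toFun := SemidirectProduct.continuous_iff.2 ⟨continuous_const, continuous_id⟩ }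
  let c : P ⋊[φ] G := SemidirectProduct.inl p
  let β : G →ₜ* P ⋊[φ] G :=
    { toMonoidHom := (MulAut.conj c).toMonoidHom.comp SemidirectProduct.inr
      continuous_toFun := (continuous_const.mul α.continuous_toFun).mul continuous_const }
  have hβ : ∀ g : G, β g = c * α g * c⁻¹ := fun _ => rfl
  -- Equality at `g` means that `c` commutes with `α g`; the two products are `(g • p, g)` and `(p,
  -- g)`.
  have comm_iff : ∀ g : G, α g = β g ↔ g • p = p := by
    intro g
    rw [hβ, eq_mul_inv_iff_mul_eq, SemidirectProduct.ext_iff]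
    have h₁ : (α g * c).left = g • p := one_mul (g • p)
    have h₂ : (c * α g).left = p := (congrArg (p * ·) (smul_one (1 : G))).trans (mul_one p)
    have h₃ : (α g * c).right = (c * α g).right := (mul_one g).trans (one_mul g).symm
    rw [h₁, h₂]
    exact and_iff_left h₃
  have hαβ : α = β := hH _ α β (ContinuousMonoidHom.ext fun h => (comm_iff h).2 (hp h h.2))
  exact (comm_iff g).1 (DFunLike.congr_fun hαβ g)

/-! ### Right translations of bounded functions on a topological group -/

section RightTranslate

variable {G : Type u} [Group G] [TopologicalSpace G] [IsTopologicalGroup G]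

/-- Right translation of bounded continuous functions on `G`. -/
def rightTranslate (g : G) (φ : G →ᵇ ℝ) : G →ᵇ ℝ := φ.compContinuous ⟨(· * g), continuous_mul_const g⟩

theorem rightTranslate_apply (g : G) (φ : G →ᵇ ℝ) (t : G) : rightTranslate g φ t = φ (t * g) := rfl

theorem rightTranslate_one (φ : G →ᵇ ℝ) : rightTranslate 1 φ = φ := by
  ext t
  rw [rightTranslate_apply, mul_one]

theorem rightTranslate_mul (g h : G) (φ : G →ᵇ ℝ) :
    rightTranslate (g * h) φ = rightTranslate g (rightTranslate h φ) := by
  ext t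
  simp only [rightTranslate_apply, mul_assoc]

variable (G) in
/-- The bounded functions on `G` whose orbit under right translations is norm continuous, that is,
the bounded functions that are uniformly continuous for the left uniformity. -/
def leftUniformBounded : AddSubgroup (G →ᵇ ℝ) where
  carrier := {φ | Continuous fun g => rightTranslate g φ}
  zero_mem' := continuous_const (y := (0 : G →ᵇ ℝ))
  add_mem' (hφ : Continuous _) (hψ : Continuous _) := hφ.add hψ
  neg_mem' (hφ : Continuous _) := hφ.neg

/-- Right translation is a left action, and the orbit map of a translate is `k ↦ k * g` followed by
the original orbit map, so the subgroup is invariant. `Multiplicative` only matches the notation of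
`G`-groups. -/
instance : MulDistribMulAction G (Multiplicative (leftUniformBounded G)) where
  smul g a := .ofAdd ⟨rightTranslate g a.toAdd.1, by
    have h := a.toAdd.2.comp (continuous_mul_const g)
    exact h.congr fun k => rightTranslate_mul k g _⟩
  one_smul a := Subtype.ext (rightTranslate_one a.toAdd.1)
  mul_smul g h a := Subtype.ext (rightTranslate_mul g h a.toAdd.1)
  smul_one _ := rfl
  smul_mul _ _ _ := rfl

/-- Orbit maps are continuous by the definition of the subgroup, and translations are 1-Lipschitz
for the sup norm; together these give joint continuity. -/
instance : ContinuousSMul G (Multiplicative (leftUniformBounded G)) where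
  continuous_smul := continuous_prod_of_continuous_lipschitzWith' _ 1
    (fun g φ ψ => BoundedContinuousFunction.lipschitz_compContinuous
      ⟨(· * g), continuous_mul_const g⟩ φ.toAdd.1 ψ.toAdd.1)
    fun a => continuous_induced_rng.2 a.toAdd.2

end RightTranslate

/-- Along each orbit, an SUC function is uniformly continuous for the left uniformity of `G`. -/
theorem IsSUCFunction.exists_leftUniformBounded {G : Type u} {X : Type v} [Group G]
    [TopologicalSpace G] [IsTopologicalGroup G] [TopologicalSpace X] [MulAction G X] {f : X →ᵇ ℝ}
    (hf : IsSUCFunction G f) (x : X) :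
    ∃ a : Multiplicative (leftUniformBounded G), ∀ t : G, a.toAdd.1 t = f (t • x) := by
  obtain ⟨Y, _, _, _, _, _, hY, ν, hν, F, hF⟩ := hf
  have hfx : ∀ t : G, f (t • x) = F (t • ν x) := fun t => by rw [hF, hν.map_smul]
  have hcont : Continuous fun t : G => f (t • x) := by
    simp only [hfx]
    fun_prop
  refine ⟨.ofAdd ⟨.ofNormedAddCommGroup (fun t => f (t • x)) hcont ‖f‖
    fun t => f.norm_coe_le_norm _, ?_⟩, fun t => rfl⟩
  refine continuous_iff_continuousAt.2 fun g => Metric.tendsto_nhds.2 fun ε hε => ?_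
  have hFu := CompactSpace.uniformContinuous_of_continuous F.continuous
  obtain ⟨U, hU, hUε⟩ := hY (ν x) _ (hFu (Metric.dist_mem_uniformity (half_pos hε)))
  have hg : ∀ᶠ k in 𝓝 g, g⁻¹ * k ∈ U :=
    (continuous_const_mul g⁻¹).tendsto' g 1 (inv_mul_cancel g) hU
  filter_upwards [hg] with k hk
  -- The supremum over `t` only preserves non-strict bounds, hence `ε / 2`.
  refine lt_of_le_of_lt ((BoundedContinuousFunction.dist_le (half_pos hε).le).2 fun t => ?_)
    (half_lt_self hε)
  -- The neighbourhood `U` serves all group elements at once, so the estimate at `t * g` is uniform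
  -- in `t`.
  have h := hUε (t * g) _ hk
  rw [mul_assoc, mul_inv_cancel_left] at h
  change dist (f ((t * k) • x)) (f ((t * g) • x)) ≤ ε / 2
  rw [hfx, hfx]
  exact le_of_lt h

/-- An SUC function on a coset space induces a continuous `G`-map into the topological `G`-group of
bounded left uniformly continuous functions, from which it is recovered by evaluation at `1`. -/
theorem IsSUCFunction.exists_equivariant_map {G : Type u} [Group G] [TopologicalSpace G]
    [IsTopologicalGroup G] {H : Subgroup G} {f : G ⧸ H →ᵇ ℝ} (hf : IsSUCFunction G f) :
    ∃ φ : G ⧸ H → Multiplicative (leftUniformBounded G), Continuous φ ∧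
      (∀ (g : G) (x : G ⧸ H), φ (g • x) = g • φ x) ∧ ∀ x, (φ x).toAdd.1 1 = f x := by
  choose φ hφ using hf.exists_leftUniformBounded
  have hsmul : ∀ (g : G) (x : G ⧸ H), φ (g • x) = g • φ x := by
    intro g x
    refine Subtype.ext (BoundedContinuousFunction.ext fun t => ?_)
    exact (hφ _ t).trans ((congrArg f (mul_smul t g x).symm).trans (hφ x (t * g)).symm)
  refine ⟨φ, ?_, hsmul, fun x => by rw [hφ, one_smul]⟩
  -- Composed with the quotient map, `φ` is the orbit map of `φ` at the base coset, which is
  -- continuous in `P`.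
  refine (QuotientGroup.isQuotientMap_mk H).continuous_iff.2 ?_
  refine (continuous_id.smul (continuous_const (y := φ ((1 : G) : G ⧸ H)))).congr fun g => ?_
  exact (hsmul g _).symm.trans (congrArg φ (congrArg QuotientGroup.mk (mul_one g)))

end

theorem mainTheorem12 {G : Type u} [Group G] [TopologicalSpace G] [IsTopologicalGroup G]
    [T2Space G] (H : Subgroup G) (hH : IsClosed (H : Set G)) :
    (∀ x₁ x₂ : G ⧸ H, AutEquivalent G x₁ x₂ → SUCEquivalent G x₁ x₂) ∧
      (IsEpiHausdorffGroup H.continuousInclusion → IsSUCTrivial G (G ⧸ H)) := by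
  refine ⟨fun x₁ x₂ hx f hf => ?_, fun hepi f hf => ?_⟩
  · obtain ⟨φ, hφ, hsmul, hval⟩ := hf.exists_equivariant_map
    obtain ⟨Φ, ⟨-, -, hΦ⟩, -⟩ := FreeTopologicalGGroup.existsUnique_lift φ hφ hsmul
    have h : φ x₁ = φ x₂ := (hΦ x₁).symm.trans ((congrArg Φ hx).trans (hΦ x₂))
    rw [← hval, ← hval, h]
  · obtain ⟨φ, -, hsmul, hval⟩ := hf.exists_equivariant_map
    refine ⟨f ((1 : G) : G ⧸ H), fun x => ?_⟩
    obtain ⟨g, rfl⟩ := QuotientGroup.mk_surjective x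
    have hmk : ∀ g : G, g • ((1 : G) : G ⧸ H) = g := fun g =>
      congrArg QuotientGroup.mk (mul_one g)
    have hfix : ∀ h ∈ H, h • φ ((1 : G) : G ⧸ H) = φ ((1 : G) : G ⧸ H) := by
      intro h hh
      rw [← hsmul, hmk]
      exact congrArg φ (QuotientGroup.eq.2 (by simpa using hh))
    rw [← hval, ← hval, ← hmk g, hsmul, hepi.smul_eq_of_forall_mem hfix]
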